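/- For a positive integer $n$ let $$Z(n)=\sum_{\substack{i+j+k=n\\ \gcd(ijk,\,n)=1}}\frac1{ijk},$$ the sum being over triples of positive integers $i,j,k$, and let $B_m$ denote the $m$-th Bernoulli number, defined by $B_0=1$ and $\sum_{i=0}^{m}\binom{m+1}{i}B_i=0$ for $m\ge 1$. For rational numbers $x,y$ whose denominators are coprime to $N$, write $x\equiv y\pmod N$ if $N$ divides the numerator of $x-y$ in lowest terms. Let $p,q$ be distinct odd primes and let $\alpha,\beta$ be positive integers. Then $$\sum_{\substack{i+j+k=p^{\alpha}q^{\beta}\\ \gcd(ijk,\,pq)=1\\ i\equiv j\equiv k\equiv 1\ (\mathrm{mod}\ 2)}}\frac1{ijk}\;\equiv\;\frac{7}{16}\,Z(p^{\alpha}q^{\beta})\;\equiv\;\frac78\,(2-q)\Bigl(1-\frac1{q^{3}}\Bigr)p^{\alpha-1}q^{\beta-1}B_{p-3}\pmod{p^{\alpha}},$$ where the sum on the left is over triples of positive integers $i,j,k$, and all three quantities have denominators coprime to $p$. -/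

import Mathlib

/-- The triples `(i, j, k)` of positive integers with `i + j + k = n` and `i`, `j`, `k` all
coprime to `m`. -/
def coprimeTriples (n m : ℕ) : Finset (ℕ × ℕ × ℕ) :=
  (Finset.Icc 1 n ×ˢ Finset.Icc 1 n ×ˢ Finset.Icc 1 n).filter fun t =>
    t.1 + t.2.1 + t.2.2 = n ∧
      Nat.Coprime t.1 m ∧ Nat.Coprime t.2.1 m ∧ Nat.Coprime t.2.2 m

/-- `Z(n)`: the sum of `1 / (i j k)` over positive integers `i, j, k` coprime to `n` with
`i + j + k = n`. -/
def harmonicZ (n : ℕ) : ℚ :=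
  ∑ t ∈ coprimeTriples n n, 1 / ((t.1 : ℚ) * (t.2.1 : ℚ) * (t.2.2 : ℚ))

/-- The sum of `1 / (i j k)` over odd positive integers `i, j, k` coprime to `m` with
`i + j + k = n`. -/
def oddHarmonicSum (n m : ℕ) : ℚ :=
  ∑ t ∈ (coprimeTriples n m).filter (fun t => Odd t.1 ∧ Odd t.2.1 ∧ Odd t.2.2),
    1 / ((t.1 : ℚ) * (t.2.1 : ℚ) * (t.2.2 : ℚ))

/-- Congruence of rational numbers modulo `m`: both denominators (in lowest terms) are coprime
to `m`, and `m` divides the numerator (in lowest terms) of the difference. -/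
def RatModEq (m : ℕ) (x y : ℚ) : Prop :=
  Nat.Coprime x.den m ∧ Nat.Coprime y.den m ∧ (m : ℤ) ∣ (x - y).num

/-! Work in `ZMod (p ^ α)`, where 1/i becomes a function F(i), set to 0 on multiples of p. The sums
over triples become coefficients of cubes of generating series.

The factor 7/16 needs only that F is odd, has an odd period P and satisfies F(2i) = F(i)/2, with 2
invertible. The coefficients W(m) of the square grow by a cyclic convolution g(m) over each period,
and g is even. Hence the coefficient at MP is linear in M, both for the cube (`coeff_cube`) and for
the series with one summand forced even (`coeff_restrictDvd_two`). Let Z and E be their values at P.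
Three odd numbers cannot add up to 2P, so inclusion-exclusion there reads 0 = 2Z - 6E + Z/4, whence
E = 3Z/8. At NP with N odd, the odd triples contribute N(Z - 3E/2) = 7NZ/16
(`sixteen_mul_coeff_odd_cube`).

For the value itself, inclusion-exclusion over multiples of q expresses the sum at q p^α through the
full sum T at p^α and Σ ⌊qi/p^α⌋ i⁻³; the cubes appear because partial fractions give F g = -2
p^(α-1) F³ (`invMod_mul_cyclicConv`). Voronoi's congruence evaluates three times that sum by B_{p-3}
(`three_mul_voronoi_sum`). Taking 2 in place of q makes the restricted sum empty, which determines
3T (`coeff_invMod_cube_three`). For p = 3 one cannot divide by 3, but both sides vanish. -/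

open Finset PowerSeries

/-! ### Odd periodic functions: linearity of coefficients at multiples of the period -/

/-- `F` is odd and periodic with period `P`, in a form suited to functions on `ℕ`. -/
structure OddPeriodic {R : Type*} [CommRing R] (F : ℕ → R) (P : ℕ) : Prop where
  zero : F 0 = 0
  add_period : ∀ i, F (i + P) = F i
  reflect : ∀ i ≤ P, F (P - i) = -F i

/-- One period of the self-convolution of `F`. -/
def cyclicConv {R : Type*} [CommRing R] (F : ℕ → R) (P r : ℕ) : R :=
  ∑ j ∈ range P, F j * F (r + P - j)

/-- The restriction of `F` to the multiples of `q`. -/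
def restrictDvd {R : Type*} [CommRing R] (q : ℕ) (F : ℕ → R) (i : ℕ) : R :=
  if q ∣ i then F i else 0

/-- The restriction of `F` to the integers not divisible by `q`. -/
def restrictNotDvd {R : Type*} [CommRing R] (q : ℕ) (F : ℕ → R) (i : ℕ) : R :=
  if q ∣ i then 0 else F i

section
variable {R : Type*} [CommRing R] {F : ℕ → R} {P : ℕ}

theorem coeff_mk_sq (F : ℕ → R) (m : ℕ) :
    coeff m (PowerSeries.mk F ^ 2) = ∑ j ∈ range (m + 1), F j * F (m - j) := by
  simp [sq, coeff_mul, Nat.sum_antidiagonal_eq_sum_range_succ_mk]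

theorem coeff_mk_mul (a : ℕ → R) (φ : R⟦X⟧) (n : ℕ) :
    coeff n (PowerSeries.mk a * φ) = ∑ m ∈ range (n + 1), a (n - m) * coeff m φ := by
  rw [mul_comm, coeff_mul, Nat.sum_antidiagonal_eq_sum_range_succ_mk]
  exact sum_congr rfl fun m _ => by simp [mul_comm]

namespace OddPeriodic

theorem add_mul_period (h : OddPeriodic F P) (i t : ℕ) : F (i + P * t) = F i := by
  induction t with
  | zero => simp
  | succ t ih => rw [mul_add, mul_one, ← add_assoc, h.add_period, ih]

theorem mod_period (h : OddPeriodic F P) (i : ℕ) : F (i % P) = F i := by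
  conv_rhs => rw [← Nat.mod_add_div i P, h.add_mul_period]

theorem reflect_mul (h : OddPeriodic F P) (M i : ℕ) (hi : i ≤ M * P) : F (M * P - i) = -F i := by
  induction M generalizing i with
  | zero => obtain rfl : i = 0 := by simpa using hi
            simp [h.zero]
  | succ M ih =>
    rcases le_or_gt i (M * P) with hi' | hi'
    · rw [show (M + 1) * P - i = (M * P - i) + P by rw [add_mul]; omega, h.add_period, ih i hi']
    · rw [show (M + 1) * P - i = P - (i - M * P) by rw [add_mul]; omega, h.reflect _ (by
        rw [add_mul] at hi; omega)]
      conv_rhs => rw [show i = (i - M * P) + P * M by rw [mul_comm P]; omega, h.add_mul_period]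

/-- The first P terms of the longer convolution are a full period; the remaining ones, shifted down
by P, are the shorter convolution. -/
theorem coeff_sq_add_period (h : OddPeriodic F P) (m : ℕ) :
    coeff (m + P) (PowerSeries.mk F ^ 2) = coeff m (PowerSeries.mk F ^ 2) + cyclicConv F P m := by
  rw [coeff_mk_sq, coeff_mk_sq, cyclicConv, show m + P + 1 = P + (m + 1) by ring,
    sum_range_add, add_comm]
  congr 1
  refine sum_congr rfl fun j hj => ?_
  rw [add_comm P j, h.add_period]
  congr 2
  omega

theorem cyclicConv_add_period (h : OddPeriodic F P) (m : ℕ) :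
    cyclicConv F P (m + P) = cyclicConv F P m := by
  refine sum_congr rfl fun j hj => ?_
  rw [mem_range] at hj
  rw [show m + P + P - j = (m + P - j) + P by omega, h.add_period]

theorem cyclicConv_add_mul_period (h : OddPeriodic F P) (r t : ℕ) :
    cyclicConv F P (r + P * t) = cyclicConv F P r := by
  induction t with
  | zero => simp
  | succ t ih => rw [mul_add, mul_one, ← add_assoc, h.cyclicConv_add_period, ih]

theorem cyclicConv_mod (h : OddPeriodic F P) (r : ℕ) :
    cyclicConv F P (r % P) = cyclicConv F P r := by
  conv_rhs => rw [← Nat.mod_add_div r P, h.cyclicConv_add_mul_period]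

theorem coeff_sq_add_mul_period (h : OddPeriodic F P) (r t : ℕ) :
    coeff (r + P * t) (PowerSeries.mk F ^ 2) = coeff r (PowerSeries.mk F ^ 2) + t * cyclicConv F P r := by
  induction t with
  | zero => simp
  | succ t ih =>
    rw [mul_add, mul_one, ← add_assoc, h.coeff_sq_add_period, ih, h.cyclicConv_add_mul_period]
    push_cast
    ring

/-- Cut the period after j = r. On the second block, j ↦ P - j reflects both factors and the two
signs cancel. -/
theorem cyclicConv_eq (h : OddPeriodic F P) (r : ℕ) (hr : r ≤ P) :
    cyclicConv F P r = coeff r (PowerSeries.mk F ^ 2) + coeff (P - r) (PowerSeries.mk F ^ 2) := by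
  have key : ∑ j ∈ range (P + 1), F j * F (r + P - j) = cyclicConv F P r := by
    rw [sum_range_succ, cyclicConv]
    have : F P = 0 := by simpa [h.zero] using h.add_period 0
    rw [this, zero_mul, add_zero]
  rw [← key, coeff_mk_sq, coeff_mk_sq, show P + 1 = (r + 1) + (P - r) by omega, sum_range_add]
  congr 1
  · refine sum_congr rfl fun j hj => ?_
    rw [mem_range] at hj
    rw [show r + P - j = (r - j) + P by omega, h.add_period]
  · rw [sum_range_succ]
    simp only [Nat.sub_self, h.zero, mul_zero, add_zero]
    rw [← sum_range_reflect]
    refine sum_congr rfl fun j hj => ?_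
    rw [mem_range] at hj
    rw [show r + 1 + (P - r - 1 - j) = P - j by omega, h.reflect _ (by omega),
      show r + P - (P - j) = P - (P - r - j) by omega, h.reflect _ (by omega), neg_mul_neg]

theorem cyclicConv_reflect (h : OddPeriodic F P) (r : ℕ) (hr : r ≤ P) :
    cyclicConv F P (P - r) = cyclicConv F P r := by
  rw [h.cyclicConv_eq r hr, h.cyclicConv_eq (P - r) (by omega), Nat.sub_sub_self hr, add_comm]

/-- `∑ a(n-m) W(m)` for `a` the restriction to multiples of `q`, evaluated at a multiple of the
period. -/
theorem coeff_restrictDvd_mul (h : OddPeriodic F P) (q M : ℕ) :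
    coeff (M * P) (PowerSeries.mk (restrictDvd q F) * PowerSeries.mk F ^ 2) =
      -∑ m ∈ range (M * P), if q ∣ M * P - m then F m * coeff m (PowerSeries.mk F ^ 2) else 0 := by
  rw [coeff_mk_mul, sum_range_succ, ← sum_neg_distrib]
  simp only [Nat.sub_self, restrictDvd, h.zero, ite_self, zero_mul, add_zero]
  refine sum_congr rfl fun m hm => ?_
  rw [mem_range] at hm
  rw [h.reflect_mul _ _ hm.le]
  split_ifs <;> simp

theorem restrictDvd_one (F : ℕ → R) : restrictDvd 1 F = F := by
  funext i; simp [restrictDvd]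

end OddPeriodic

theorem sum_range_mul_period (f : ℕ → R) (M P : ℕ) :
    ∑ m ∈ range (M * P), f m = ∑ t ∈ range M, ∑ r ∈ range P, f (r + P * t) := by
  induction M with
  | zero => simp
  | succ M ih =>
    rw [add_mul, one_mul, sum_range_add, ih, sum_range_succ]
    congr 1
    exact sum_congr rfl fun r _ => by rw [add_comm, mul_comm]

theorem sum_range_reflect_period (f : ℕ → R) (h0 : f 0 = 0) (hP : f P = 0) :
    ∑ r ∈ range P, f (P - r) = ∑ r ∈ range P, f r := by
  have h1 : ∑ r ∈ range (P + 1), f (P - r) = ∑ r ∈ range P, f (P - r) := by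
    rw [sum_range_succ]; simp [h0]
  have h2 : ∑ r ∈ range (P + 1), f r = ∑ r ∈ range P, f r := by
    rw [sum_range_succ]; simp [hP]
  rw [← h1, ← h2, ← sum_range_reflect f (P + 1)]
  exact sum_congr rfl fun j _ => by rw [Nat.add_sub_cancel]

namespace OddPeriodic

theorem period_eq_zero (h : OddPeriodic F P) : F P = 0 := by
  simpa [h.zero] using h.add_period 0

theorem two_mul_sum_mul_cyclicConv (h : OddPeriodic F P) :
    2 * ∑ r ∈ range P, F r * cyclicConv F P r = 0 := by
  have := sum_range_reflect_period (P := P) (fun r => F r * cyclicConv F P r) (by simp [h.zero])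
    (by simp [h.period_eq_zero])
  rw [sum_congr rfl (g := fun r => -(F r * cyclicConv F P r))] at this
  · rw [sum_neg_distrib] at this
    linear_combination -this
  · intro r hr
    rw [mem_range] at hr
    rw [h.reflect r hr.le, h.cyclicConv_reflect r hr.le, neg_mul]

/-- Passing from r to r + Pt adds t Σ F g to the sum of F W over a period, and this vanishes because
F is odd and g even. Every period thus contributes equally. -/
theorem coeff_cube (h : OddPeriodic F P) (h2 : IsUnit (2 : R)) (M : ℕ) :
    coeff (M * P) (PowerSeries.mk F ^ 3) = (M : R) * coeff P (PowerSeries.mk F ^ 3) := by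
  have hg : ∑ r ∈ range P, F r * cyclicConv F P r = 0 :=
    h2.mul_left_cancel (by rw [h.two_mul_sum_mul_cyclicConv, mul_zero])
  have key : ∀ M : ℕ, coeff (M * P) (PowerSeries.mk F ^ 3) =
      (M : R) * -∑ r ∈ range P, F r * coeff r (PowerSeries.mk F ^ 2) := by
    intro M
    have := h.coeff_restrictDvd_mul 1 M
    rw [restrictDvd_one, ← pow_succ'] at this
    rw [this]
    simp only [one_dvd, if_true]
    rw [sum_range_mul_period]
    have : ∀ t ∈ range M, ∑ r ∈ range P, F (r + P * t) * coeff (r + P * t) (PowerSeries.mk F ^ 2) =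
        ∑ r ∈ range P, F r * coeff r (PowerSeries.mk F ^ 2) := by
      intro t _
      simp only [h.add_mul_period, h.coeff_sq_add_mul_period, mul_add, sum_add_distrib]
      rw [add_eq_left, ← mul_zero (t : R), ← hg, mul_sum]
      exact sum_congr rfl fun _ _ => by ring
    rw [sum_congr rfl this]
    simp
  have h1 := key 1
  rw [one_mul, Nat.cast_one, one_mul] at h1
  rw [key M, h1]

/-- Restricting one summand to even integers: the sum over `i + j + k = M P` is linear in `M`. -/
theorem coeff_restrictDvd_two (h : OddPeriodic F P) (hP : Odd P) (M : ℕ) :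
    coeff (M * P) (PowerSeries.mk (restrictDvd 2 F) * PowerSeries.mk F ^ 2) =
      (M : R) * coeff P (PowerSeries.mk (restrictDvd 2 F) * PowerSeries.mk F ^ 2) := by
  -- As P is odd, r ↦ P - r swaps even and odd residues, so the sums over odd r are determined by
  -- the even ones A and B.
  set A := ∑ r ∈ range P, if Even r then F r * cyclicConv F P r else 0 with hA
  set B := ∑ r ∈ range P, if Even r then F r * coeff r (PowerSeries.mk F ^ 2) else 0 with hB
  have par : ∀ r ≤ P, (Even (P - r) ↔ ¬ Even r) := fun r hr => by
    rw [Nat.even_sub hr]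
    simp [Nat.not_even_iff_odd.2 hP]
  have hoA : (∑ r ∈ range P, if Even r then 0 else F r * cyclicConv F P r) = -A := by
    rw [hA, ← sum_range_reflect_period, ← sum_neg_distrib]
    · refine sum_congr rfl fun r hr => ?_
      rw [mem_range] at hr
      simp only [par r hr.le]
      rw [h.reflect r hr.le, h.cyclicConv_reflect r hr.le]
      split_ifs <;> simp_all
    · simp
    · simp [h.period_eq_zero]
  have hoB : (∑ r ∈ range P, if Even r then 0 else F r * coeff r (PowerSeries.mk F ^ 2)) = B - A := by
    rw [hA, hB, ← sum_range_reflect_period, ← sum_sub_distrib]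
    · refine sum_congr rfl fun r hr => ?_
      rw [mem_range] at hr
      simp only [par r hr.le]
      rw [h.reflect r hr.le, h.cyclicConv_eq r hr.le]
      split_ifs <;> first | contradiction | ring
    · simp
    · simp [h.period_eq_zero]
  have key : ∀ M : ℕ, coeff (M * P) (PowerSeries.mk (restrictDvd 2 F) * PowerSeries.mk F ^ 2) =
      -∑ t ∈ range M, if (Even M ↔ Even t) then B + t * A else B - A - t * A := by
    intro M
    rw [h.coeff_restrictDvd_mul 2 M, sum_range_mul_period]
    congr 1
    refine sum_congr rfl fun t ht => ?_
    rw [mem_range] at ht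
    have hd : ∀ r ∈ range P, (2 ∣ M * P - (r + P * t) ↔ ((Even M ↔ Even t) ↔ Even r)) := by
      intro r hr
      rw [mem_range] at hr
      have : r + P * t ≤ M * P := by nlinarith
      rw [← even_iff_two_dvd, Nat.even_sub this, Nat.even_mul, Nat.even_add, Nat.even_mul]
      simp only [Nat.not_even_iff_odd.2 hP, or_false, false_or]
      tauto
    rw [sum_congr rfl (g := fun r => if ((Even M ↔ Even t) ↔ Even r) then
        F r * coeff r (PowerSeries.mk F ^ 2) + t * (F r * cyclicConv F P r) else 0)]
    · split_ifs with hMt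
      · rw [hA, hB, mul_sum, ← sum_add_distrib]
        refine sum_congr rfl fun r _ => ?_
        simp only [hMt, true_iff]
        split_ifs <;> simp
      · rw [sub_eq_add_neg _ ((t : R) * A), ← mul_neg, ← hoA, ← hoB, mul_sum, ← sum_add_distrib]
        refine sum_congr rfl fun r _ => ?_
        simp only [hMt, false_iff]
        split_ifs <;> simp
    · intro r hr
      simp only [hd r hr, h.add_mul_period, h.coeff_sq_add_mul_period]
      split_ifs <;> ring
  -- Consecutive t, the first of the parity of M, contribute (B + tA) + (B - A - (t+1)A) = 2(B - A);
  -- an odd M leaves the single term B - A at t = 0.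
  have lin : ∀ M : ℕ, coeff (M * P) (PowerSeries.mk (restrictDvd 2 F) * PowerSeries.mk F ^ 2) = M * (A - B) := by
    intro M
    rw [key]
    rcases Nat.even_or_odd' M with ⟨K, rfl | rfl⟩
    · simp only [even_two_mul, true_iff]
      induction K with
      | zero => simp
      | succ K ih =>
        rw [mul_add, mul_one, sum_range_succ, sum_range_succ, neg_add, neg_add, ih]
        simp
        ring
    · have : ¬ Even (2 * K + 1) := by simp
      simp only [this, false_iff]
      induction K with
      | zero => simp
      | succ K ih =>
        rw [show 2 * (K + 1) + 1 = 2 * K + 1 + 1 + 1 by ring, sum_range_succ, sum_range_succ,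
          neg_add, neg_add, ih (by simp)]
        simp [Nat.even_add_one]
        ring
  have h1 := lin 1
  rw [one_mul, Nat.cast_one, one_mul] at h1
  rw [lin M, h1]

end OddPeriodic
end

/-! ### Inclusion-exclusion, dilation and the factor 7/16 -/

section
variable {R : Type*} [CommRing R] {F : ℕ → R} {P : ℕ}

theorem mk_restrictNotDvd (q : ℕ) (F : ℕ → R) :
    PowerSeries.mk (restrictNotDvd q F) =
      PowerSeries.mk F - PowerSeries.mk (restrictDvd q F) := by
  ext i
  simp only [coeff_mk, map_sub, restrictNotDvd, restrictDvd]
  split_ifs <;> simp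

theorem mk_restrictDvd_eq_expand {q : ℕ} (hq : q ≠ 0) {c : R} (hc : ∀ i, F (q * i) = c * F i) :
    PowerSeries.mk (restrictDvd q F) = C c * expand q hq (PowerSeries.mk F) := by
  ext i
  rw [coeff_mk, coeff_C_mul, coeff_expand, restrictDvd]
  split_ifs with h
  · obtain ⟨j, rfl⟩ := h
    rw [Nat.mul_div_cancel_left _ (Nat.pos_of_ne_zero hq), coeff_mk, hc]
  · simp

theorem coeff_restrictDvd_cube {q : ℕ} (hq : q ≠ 0) {c : R} (hc : ∀ i, F (q * i) = c * F i)
    (n : ℕ) : coeff (q * n) (PowerSeries.mk (restrictDvd q F) ^ 3) =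
      c ^ 3 * coeff n (PowerSeries.mk F ^ 3) := by
  rw [mk_restrictDvd_eq_expand hq hc, mul_pow, ← map_pow, ← map_pow, coeff_C_mul, coeff_expand_mul]

/-- The power series `φ` has nonzero coefficients only at indices in the residue class `c`. -/
def SupportedOnClass {q : ℕ} (φ : R⟦X⟧) (c : ZMod q) : Prop :=
  ∀ i : ℕ, (i : ZMod q) ≠ c → coeff i φ = 0

theorem SupportedOnClass.mul {q : ℕ} {φ ψ : R⟦X⟧} {c d : ZMod q} (hφ : SupportedOnClass φ c)
    (hψ : SupportedOnClass ψ d) : SupportedOnClass (φ * ψ) (c + d) := by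
  intro n hn
  rw [coeff_mul]
  refine sum_eq_zero fun x hx => ?_
  rw [HasAntidiagonal.mem_antidiagonal] at hx
  by_cases h1 : (x.1 : ZMod q) = c
  · rw [hψ x.2, mul_zero]
    rintro h2
    exact hn (by rw [← hx, Nat.cast_add, h1, h2])
  · rw [hφ x.1 h1, zero_mul]

theorem supportedOnClass_restrictDvd (q : ℕ) (F : ℕ → R) :
    SupportedOnClass (PowerSeries.mk (restrictDvd q F)) (0 : ZMod q) := by
  intro i hi
  rw [coeff_mk, restrictDvd, if_neg]
  rwa [← ZMod.natCast_eq_zero_iff]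

theorem supportedOnClass_restrictNotDvd_two (F : ℕ → R) :
    SupportedOnClass (PowerSeries.mk (restrictNotDvd 2 F)) (1 : ZMod 2) := by
  intro i hi
  rw [coeff_mk, restrictNotDvd, if_pos]
  rw [← ZMod.natCast_eq_zero_iff]
  generalize (i : ZMod 2) = x at *
  decide +revert

/-- Inclusion-exclusion for triples with a sum divisible by `q`. -/
theorem coeff_restrictNotDvd_cube {q n : ℕ} (hn : q ∣ n) (F : ℕ → R) :
    coeff n (PowerSeries.mk (restrictNotDvd q F) ^ 3) = coeff n (PowerSeries.mk F ^ 3) -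
      3 * coeff n (PowerSeries.mk (restrictDvd q F) * PowerSeries.mk F ^ 2) +
      2 * coeff n (PowerSeries.mk (restrictDvd q F) ^ 3) := by
  -- If two summands and the total are multiples of q, so is the third.
  have hz : coeff n (PowerSeries.mk (restrictNotDvd q F) *
      (PowerSeries.mk (restrictDvd q F) * PowerSeries.mk (restrictDvd q F))) = 0 := by
    rw [coeff_mul]
    refine sum_eq_zero fun x hx => ?_
    rw [HasAntidiagonal.mem_antidiagonal] at hx
    by_cases h1 : q ∣ x.1
    · rw [coeff_mk, restrictNotDvd, if_pos h1, zero_mul]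
    · rw [((supportedOnClass_restrictDvd q F).mul (supportedOnClass_restrictDvd q F)) x.2, mul_zero]
      rw [add_zero, Ne, ZMod.natCast_eq_zero_iff]
      intro h2
      exact h1 ((Nat.dvd_add_left h2).1 (hx ▸ hn))
  rw [mk_restrictNotDvd] at hz ⊢
  set f := PowerSeries.mk F
  set a := PowerSeries.mk (restrictDvd q F)
  have e : (f - a) ^ 3 = f ^ 3 - C 3 * (a * f ^ 2) + C 2 * a ^ 3 + C 3 * ((f - a) * (a * a)) := by
    simp only [map_ofNat]
    ring
  rw [e]
  simp only [map_add, map_sub, coeff_C_mul, hz, mul_zero, add_zero]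

/-- With f = o + a split into odd and even parts, only o³ and o a² reach odd indices; 2f³ - 3af²
cancels the latter. -/
theorem two_mul_coeff_odd_cube {n : ℕ} (hn : Odd n) (F : ℕ → R) :
    2 * coeff n (PowerSeries.mk (restrictNotDvd 2 F) ^ 3) = 2 * coeff n (PowerSeries.mk F ^ 3) -
      3 * coeff n (PowerSeries.mk (restrictDvd 2 F) * PowerSeries.mk F ^ 2) := by
  have ho := supportedOnClass_restrictNotDvd_two F
  have ha := supportedOnClass_restrictDvd 2 F
  have hn1 : (n : ZMod 2) = 1 := ZMod.natCast_eq_one_iff_odd.2 hn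
  have h1 := (ho.mul (ho.mul ha)) n (by rw [hn1]; decide)
  have h2 := (ha.mul (ha.mul ha)) n (by rw [hn1]; decide)
  rw [mk_restrictNotDvd] at h1 ⊢
  set f := PowerSeries.mk F
  set a := PowerSeries.mk (restrictDvd 2 F)
  have e : C 2 * (f - a) ^ 3 = C 2 * f ^ 3 - C 3 * (a * f ^ 2)
      - C 3 * ((f - a) * ((f - a) * a)) + a * (a * a) := by
    simp only [map_ofNat]
    ring
  have := congrArg (coeff n) e
  simpa only [map_add, map_sub, coeff_C_mul, h1, h2, mul_zero, add_zero, sub_zero] using this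

theorem coeff_odd_cube_of_even {n : ℕ} (hn : Even n) (F : ℕ → R) :
    coeff n (PowerSeries.mk (restrictNotDvd 2 F) ^ 3) = 0 := by
  have ho := supportedOnClass_restrictNotDvd_two F
  have hn0 : (n : ZMod 2) = 0 := (ZMod.natCast_eq_zero_iff n 2).2 hn.two_dvd
  have := (ho.mul (ho.mul ho)) n (by rw [hn0]; decide)
  rwa [← pow_two, ← pow_succ'] at this

theorem sum_range_ite_dvd (f : ℕ → R) {q : ℕ} (hq : q ≠ 0) (P : ℕ) :
    (∑ m ∈ range (q * P), if q ∣ m then f m else 0) = ∑ i ∈ range P, f (q * i) := by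
  rw [mul_comm, sum_range_mul_period]
  refine sum_congr rfl fun t _ => ?_
  rw [sum_eq_single_of_mem 0 (by simp [Nat.pos_of_ne_zero hq])]
  · simp
  · intro r hr hr0
    rw [if_neg]
    rw [Nat.dvd_add_left (dvd_mul_right _ _)]
    exact fun h => hr0 (Nat.eq_zero_of_dvd_of_lt h (mem_range.1 hr))

theorem sum_range_mul_mod (f : ℕ → R) {q P : ℕ} (hqP : q.Coprime P) :
    ∑ i ∈ range P, f (q * i % P) = ∑ r ∈ range P, f r := by
  rcases Nat.eq_zero_or_pos P with rfl | hP
  · simp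
  have hinj : Set.InjOn (fun i => q * i % P) (range P : Set ℕ) := by
    intro i hi j hj hij
    rw [mem_coe, mem_range] at hi hj
    have : i ≡ j [MOD P] := Nat.ModEq.cancel_left_of_coprime (Nat.coprime_comm.1 hqP) hij
    rwa [Nat.ModEq, Nat.mod_eq_of_lt hi, Nat.mod_eq_of_lt hj] at this
  have himg : (range P).image (fun i => q * i % P) = range P := by
    refine eq_of_subset_of_card_le ?_ ?_
    · intro x hx
      obtain ⟨i, _, rfl⟩ := mem_image.1 hx
      exact mem_range.2 (Nat.mod_lt _ hP)
    · rw [card_image_of_injOn hinj]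
  rw [← sum_image (f := f) hinj, himg]

namespace OddPeriodic

theorem coeff_cube_period (h : OddPeriodic F P) :
    coeff P (PowerSeries.mk F ^ 3) = -∑ r ∈ range P, F r * coeff r (PowerSeries.mk F ^ 2) := by
  have := h.coeff_restrictDvd_mul 1 1
  simpa [restrictDvd_one, ← pow_succ'] using this

/-- Multiplication by q permutes the residues mod P, so reducing qi recovers the sum for the cube at
P. Each of the ⌊qi/P⌋ periods removed from W costs one g(qi). -/
theorem coeff_restrictDvd_mul_period (h : OddPeriodic F P) {q : ℕ} (hq : q ≠ 0)
    (hqP : q.Coprime P) :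
    coeff (q * P) (PowerSeries.mk (restrictDvd q F) * PowerSeries.mk F ^ 2) =
      coeff P (PowerSeries.mk F ^ 3) -
        ∑ i ∈ range P, ((q * i / P : ℕ) : R) * (F (q * i) * cyclicConv F P (q * i)) := by
  have hW : ∀ i ∈ range P, F (q * i) * coeff (q * i) (PowerSeries.mk F ^ 2) =
      F (q * i % P) * coeff (q * i % P) (PowerSeries.mk F ^ 2) +
        ((q * i / P : ℕ) : R) * (F (q * i) * cyclicConv F P (q * i)) := by
    intro i _
    conv_lhs => rw [← Nat.mod_add_div (q * i) P, h.coeff_sq_add_mul_period, h.add_mul_period]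
    rw [h.cyclicConv_mod, mul_add, h.mod_period]
    ring
  have hdvd : ∀ m ∈ range (q * P), (q ∣ q * P - m ↔ q ∣ m) := fun m hm =>
    Nat.dvd_sub_iff_right (mem_range.1 hm).le (dvd_mul_right _ _)
  rw [h.coeff_restrictDvd_mul, sum_congr rfl (g := fun m => if q ∣ m then
    F m * coeff m (PowerSeries.mk F ^ 2) else 0) (fun m hm => by simp only [hdvd m hm]),
    sum_range_ite_dvd (fun m => F m * coeff m (PowerSeries.mk F ^ 2)) hq, sum_congr rfl hW,
    sum_add_distrib, sum_range_mul_mod (fun r => F r * coeff r (PowerSeries.mk F ^ 2)) hqP,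
    h.coeff_cube_period]
  ring

/-- The sum over triples of odd integers is `7/16` of the full sum. -/
theorem sixteen_mul_coeff_odd_cube (h : OddPeriodic F P) (hP : Odd P) {c : R} (hc2 : 2 * c = 1)
    (hc : ∀ i, F (2 * i) = c * F i) {N : ℕ} (hN : Odd N) :
    16 * coeff (N * P) (PowerSeries.mk (restrictNotDvd 2 F) ^ 3) =
      7 * coeff (N * P) (PowerSeries.mk F ^ 3) := by
  have h2 : IsUnit (2 : R) := IsUnit.of_mul_eq_one c hc2
  have h8 : (2 : R) ^ 3 * c ^ 3 = 1 := by rw [← mul_pow, hc2, one_pow]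
  have e0 := coeff_restrictNotDvd_cube (dvd_mul_right 2 P) F
  rw [coeff_odd_cube_of_even (even_two_mul P), coeff_restrictDvd_cube two_ne_zero hc,
    h.coeff_cube h2, h.coeff_restrictDvd_two hP] at e0
  have e1 := two_mul_coeff_odd_cube (hN.mul hP) F
  rw [h.coeff_cube h2, h.coeff_restrictDvd_two hP] at e1
  rw [h.coeff_cube h2]
  push_cast at e0
  set Z := coeff P (PowerSeries.mk F ^ 3)
  set E := coeff P (PowerSeries.mk (restrictDvd 2 F) * PowerSeries.mk F ^ 2)
  -- This is the relation at index 2P, cleared of denominators using 8c³ = 1.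
  have e2 : 24 * E = 9 * Z := by
    refine h2.mul_left_cancel ?_
    linear_combination 8 * e0 + 2 * Z * h8
  linear_combination 8 * e1 - N * e2

end OddPeriodic
end

/-! ### Sums of inverses modulo a prime power -/

theorem ZMod.sum_range_natCast {R : Type*} [AddCommMonoid R] (n : ℕ) [NeZero n] (f : ZMod n → R) :
    ∑ m ∈ range n, f (m : ZMod n) = ∑ x, f x :=
  sum_nbij' (fun m => (m : ZMod n)) ZMod.val (by simp) (fun x _ => by simp [ZMod.val_lt])
    (fun m hm => ZMod.val_cast_of_lt (mem_range.1 hm)) (by simp) (by simp)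

theorem Ring.inverse_neg' {R : Type*} [CommRing R] (x : R) : Ring.inverse (-x) = -Ring.inverse x := by
  have h1 : Ring.inverse (-1 : R) = -1 := by
    have h := Ring.inverse_mul_cancel (-1 : R) isUnit_one.neg
    linear_combination -h
  rw [neg_eq_neg_one_mul, Ring.mul_inverse_rev, h1, mul_neg_one]

section
variable {p α : ℕ}

theorem natCast_dvd_natCast_zmod_prime_pow [Fact p.Prime] (hα : 1 ≤ α) (m : ℕ) :
    (p : ZMod (p ^ α)) ∣ m ↔ p ∣ m := by
  refine ⟨?_, fun h => Nat.cast_dvd_cast h⟩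
  rintro ⟨c, hc⟩
  obtain ⟨k, rfl⟩ := ZMod.natCast_zmod_surjective c
  rw [← Nat.cast_mul, ZMod.natCast_eq_natCast_iff] at hc
  have := hc.of_dvd (dvd_pow_self p (by omega))
  exact (this.dvd_iff dvd_rfl).2 (dvd_mul_right _ _)

theorem isUnit_natCast_zmod_prime_pow [hp : Fact p.Prime] (hα : 1 ≤ α) (m : ℕ) :
    IsUnit (m : ZMod (p ^ α)) ↔ ¬ p ∣ m := by
  rw [ZMod.isUnit_iff_coprime, Nat.coprime_pow_right_iff (by omega), Nat.coprime_comm,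
    hp.out.coprime_iff_not_dvd]

theorem isUnit_zmod_prime_pow_iff [hp : Fact p.Prime] (hα : 1 ≤ α) (x : ZMod (p ^ α)) :
    IsUnit x ↔ ¬ (p : ZMod (p ^ α)) ∣ x := by
  obtain ⟨m, rfl⟩ := ZMod.natCast_zmod_surjective x
  rw [isUnit_natCast_zmod_prime_pow hα, natCast_dvd_natCast_zmod_prime_pow hα]

theorem sum_eq_zero_of_odd {R : Type*} [CommRing R] [Fintype R] (h2 : IsUnit (2 : R))
    (s : Finset R) (hs : ∀ x ∈ s, -x ∈ s) (f : R → R) (hf : ∀ x, f (-x) = -f x) :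
    ∑ x ∈ s, f x = 0 := by
  have : ∑ x ∈ s, f x = ∑ x ∈ s, -f x :=
    sum_nbij' (fun x => -x) (fun x => -x) hs hs (by simp) (by simp) (by simp [hf])
  rw [sum_neg_distrib] at this
  exact h2.mul_left_cancel (by linear_combination this)

open Classical in
theorem sum_multiples_one [hp : Fact p.Prime] (hα : 1 ≤ α) :
    (∑ x : ZMod (p ^ α), if (p : ZMod (p ^ α)) ∣ x then (1 : ZMod (p ^ α)) else 0) =
      (p : ZMod (p ^ α)) ^ (α - 1) := by
  rw [← ZMod.sum_range_natCast]
  simp only [natCast_dvd_natCast_zmod_prime_pow hα]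
  have hP : p ^ α = p * p ^ (α - 1) := by rw [← pow_succ', Nat.sub_add_cancel hα]
  have := sum_range_ite_dvd (fun _ => (1 : ZMod (p ^ α))) hp.out.ne_zero (p ^ (α - 1))
  rw [← hP] at this
  rw [this]
  simp

open Classical in
-- Inversion maps the class of u mod p onto the class of u⁻¹. That class is u⁻¹ - z for the p^(α-1)
-- multiples z of p, and these z sum to 0 by symmetry.
theorem sum_inverse_residue_class [hp : Fact p.Prime] (hα : 1 ≤ α)
    (h2 : IsUnit (2 : ZMod (p ^ α))) {u : ZMod (p ^ α)} (hu : IsUnit u) :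
    ∑ x with (p : ZMod (p ^ α)) ∣ u - x, Ring.inverse x =
      (p : ZMod (p ^ α)) ^ (α - 1) * Ring.inverse u := by
  have hunit : ∀ v x : ZMod (p ^ α), IsUnit v → (p : ZMod (p ^ α)) ∣ v - x → IsUnit x := by
    intro v x hv hx
    rw [isUnit_zmod_prime_pow_iff hα] at hv ⊢
    exact fun h => hv (by simpa using dvd_add hx h)
  have hdvd : ∀ v x : ZMod (p ^ α), IsUnit v → (p : ZMod (p ^ α)) ∣ v - x →
      (p : ZMod (p ^ α)) ∣ Ring.inverse v - Ring.inverse x := by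
    intro v x hv hx
    have hx' := hunit v x hv hx
    have h1 := Ring.inverse_mul_cancel v hv
    have h2 := Ring.inverse_mul_cancel x hx'
    have : Ring.inverse v - Ring.inverse x = (v - x) * (-(Ring.inverse v * Ring.inverse x)) := by
      linear_combination Ring.inverse x * h1 - Ring.inverse v * h2
    rw [this]
    exact Dvd.dvd.mul_right hx _
  have hiu : IsUnit (Ring.inverse u) := hu.ringInverse
  have e1 : ∑ x with (p : ZMod (p ^ α)) ∣ u - x, Ring.inverse x =
      ∑ x with (p : ZMod (p ^ α)) ∣ Ring.inverse u - x, x := by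
    refine sum_nbij' Ring.inverse Ring.inverse ?_ ?_ ?_ ?_ ?_
    · simpa using fun x hx => hdvd u x hu hx
    · intro x hx
      simp only [mem_filter, mem_univ, true_and] at hx ⊢
      have := hdvd _ x hiu hx
      rwa [Ring.inverse_inverse hu] at this
    · intro x hx
      simp only [mem_filter, mem_univ, true_and] at hx
      exact Ring.inverse_inverse (hunit u x hu hx)
    · intro x hx
      simp only [mem_filter, mem_univ, true_and] at hx
      exact Ring.inverse_inverse (hunit _ x hiu hx)
    · simp
  have e2 : ∑ x with (p : ZMod (p ^ α)) ∣ Ring.inverse u - x, x =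
      ∑ z with (p : ZMod (p ^ α)) ∣ z, (Ring.inverse u - z) :=
    sum_nbij' (fun x => Ring.inverse u - x) (fun x => Ring.inverse u - x) (by simp) (by simp)
      (by simp) (by simp) (by simp)
  have e3 : ∑ z with (p : ZMod (p ^ α)) ∣ z, z = 0 :=
    sum_eq_zero_of_odd h2 _ (by simp) (fun z => z) (by simp)
  rw [e1, e2, sum_sub_distrib, e3, sub_zero, ← sum_multiples_one hα, sum_mul, sum_filter]
  exact sum_congr rfl fun x _ => by split_ifs <;> simp

open Classical in
-- Partial fractions: u/(x(u-x)) = 1/x + 1/(u-x) when x and u - x are units. Each half is the sum of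
-- all inverses, which is 0, minus the sum over the class of u.
theorem sum_inverse_mul_inverse_sub [hp : Fact p.Prime] (hα : 1 ≤ α)
    (h2 : IsUnit (2 : ZMod (p ^ α))) {u : ZMod (p ^ α)} (hu : IsUnit u) :
    u * ∑ x : ZMod (p ^ α), Ring.inverse x * Ring.inverse (u - x) =
      -2 * (p : ZMod (p ^ α)) ^ (α - 1) * Ring.inverse u := by
  have pt : ∀ x : ZMod (p ^ α), u * (Ring.inverse x * Ring.inverse (u - x)) =
      (if (p : ZMod (p ^ α)) ∣ u - x then 0 else Ring.inverse x) +
        if (p : ZMod (p ^ α)) ∣ x then 0 else Ring.inverse (u - x) := by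
    intro x
    by_cases h1 : (p : ZMod (p ^ α)) ∣ x
    · rw [if_pos h1, Ring.inverse_non_unit x (by rw [isUnit_zmod_prime_pow_iff hα]; simpa)]
      simp
    · by_cases h3 : (p : ZMod (p ^ α)) ∣ u - x
      · rw [if_pos h3, Ring.inverse_non_unit (u - x) (by rw [isUnit_zmod_prime_pow_iff hα]; simpa)]
        simp
      · rw [if_neg h1, if_neg h3]
        have hx := Ring.inverse_mul_cancel x ((isUnit_zmod_prime_pow_iff hα x).2 h1)
        have hux := Ring.inverse_mul_cancel (u - x) ((isUnit_zmod_prime_pow_iff hα (u - x)).2 h3)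
        linear_combination Ring.inverse (u - x) * hx + Ring.inverse x * hux
  have e1 : (∑ x : ZMod (p ^ α), if (p : ZMod (p ^ α)) ∣ x then 0 else Ring.inverse (u - x)) =
      ∑ x : ZMod (p ^ α), if (p : ZMod (p ^ α)) ∣ u - x then 0 else Ring.inverse x :=
    sum_nbij' (fun x => u - x) (fun x => u - x) (by simp) (by simp) (by simp) (by simp) (by simp)
  have e2 : (∑ x : ZMod (p ^ α), if (p : ZMod (p ^ α)) ∣ u - x then 0 else Ring.inverse x) =
      ∑ x : ZMod (p ^ α), Ring.inverse x -
        ∑ x with (p : ZMod (p ^ α)) ∣ u - x, Ring.inverse x := by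
    rw [sum_filter, ← sum_sub_distrib]
    exact sum_congr rfl fun x _ => by split_ifs <;> simp
  have e3 : ∑ x : ZMod (p ^ α), Ring.inverse x = 0 :=
    sum_eq_zero_of_odd h2 _ (by simp) _ Ring.inverse_neg'
  rw [mul_sum, sum_congr rfl fun x _ => pt x, sum_add_distrib, e1, e2, e3,
    sum_inverse_residue_class hα h2 hu]
  ring

/-- The inverse of `i` modulo `p ^ α`, extended by zero to multiples of `p`. -/
noncomputable def invMod (p α i : ℕ) : ZMod (p ^ α) := Ring.inverse (i : ZMod (p ^ α))

theorem invMod_mul (i j : ℕ) : invMod p α (i * j) = invMod p α i * invMod p α j := by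
  rw [invMod, Nat.cast_mul, Ring.mul_inverse_rev, mul_comm]
  rfl

theorem oddPeriodic_invMod : OddPeriodic (invMod p α) (p ^ α) where
  zero := by simp [invMod]
  add_period i := by rw [invMod, Nat.cast_add, ZMod.natCast_self, add_zero]; rfl
  reflect i hi := by
    rw [invMod, Nat.cast_sub hi, ZMod.natCast_self, zero_sub, Ring.inverse_neg']; rfl

theorem OddPeriodic.restrictNotDvd {R : Type*} [CommRing R] {F : ℕ → R} {P : ℕ}
    (h : OddPeriodic F P) (q : ℕ) : OddPeriodic (restrictNotDvd q F) (q * P) where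
  zero := by simp [_root_.restrictNotDvd]
  add_period i := by
    simp only [_root_.restrictNotDvd, Nat.dvd_add_left (dvd_mul_right q P)]
    rw [mul_comm q P, h.add_mul_period]
  reflect i hi := by
    simp only [_root_.restrictNotDvd, Nat.dvd_sub_iff_right hi (dvd_mul_right q P)]
    rw [h.reflect_mul q i hi]
    split_ifs <;> simp

theorem invMod_mul_cyclicConv [hp : Fact p.Prime] (hα : 1 ≤ α) (h2 : IsUnit (2 : ZMod (p ^ α)))
    (r : ℕ) : invMod p α r * cyclicConv (invMod p α) (p ^ α) r =
      -2 * (p : ZMod (p ^ α)) ^ (α - 1) * invMod p α r ^ 3 := by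
  have hc : cyclicConv (invMod p α) (p ^ α) r =
      ∑ x : ZMod (p ^ α), Ring.inverse x * Ring.inverse ((r : ZMod (p ^ α)) - x) := by
    rw [← ZMod.sum_range_natCast, cyclicConv]
    refine sum_congr rfl fun j hj => ?_
    rw [mem_range] at hj
    rw [invMod, invMod, Nat.cast_sub (by omega), Nat.cast_add, ZMod.natCast_self, add_zero]
  by_cases hr : IsUnit (r : ZMod (p ^ α))
  · have h := sum_inverse_mul_inverse_sub hα h2 hr
    rw [← hc] at h
    have hi : invMod p α r * r = 1 := Ring.inverse_mul_cancel _ hr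
    change _ = _ * _ * invMod p α r at h
    linear_combination invMod p α r ^ 2 * h - invMod p α r * cyclicConv (invMod p α) (p ^ α) r * hi
  · rw [invMod, Ring.inverse_non_unit _ hr]
    simp

theorem coeff_invMod_restrictDvd [hp : Fact p.Prime] (hα : 1 ≤ α) (h2 : IsUnit (2 : ZMod (p ^ α)))
    {q : ℕ} (hq : q ≠ 0) (hqp : q.Coprime p) :
    coeff (q * p ^ α) (PowerSeries.mk (restrictDvd q (invMod p α)) *
        PowerSeries.mk (invMod p α) ^ 2) =
      coeff (p ^ α) (PowerSeries.mk (invMod p α) ^ 3) +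
        2 * (p : ZMod (p ^ α)) ^ (α - 1) * invMod p α q ^ 3 *
          ∑ i ∈ range (p ^ α), ((q * i / p ^ α : ℕ) : ZMod (p ^ α)) * invMod p α i ^ 3 := by
  rw [oddPeriodic_invMod.coeff_restrictDvd_mul_period hq (hqp.pow_right α), sub_eq_add_neg,
    ← sum_neg_distrib, mul_sum]
  congr 1
  refine sum_congr rfl fun i _ => ?_
  rw [invMod_mul_cyclicConv hα h2, invMod_mul]
  ring

end

/-! ### Residues of rational numbers -/

/-- The rational number `x` has denominator coprime to `N` and residue `a` modulo `N`. -/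
def ReducesTo (N : ℕ) (x : ℚ) (a : ZMod N) : Prop :=
  ∃ (u : ℤ) (v : ℕ), v.Coprime N ∧ x * v = u ∧ a * v = u

namespace ReducesTo
variable {N : ℕ} {x y : ℚ} {a b : ZMod N}

theorem intCast (z : ℤ) : ReducesTo N z z := ⟨z, 1, by simp, by simp, by simp⟩

theorem natCast (n : ℕ) : ReducesTo N n n := ⟨n, 1, by simp, by simp, by simp⟩

theorem add (hx : ReducesTo N x a) (hy : ReducesTo N y b) : ReducesTo N (x + y) (a + b) := by
  obtain ⟨u, v, hv, h1, h2⟩ := hx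
  obtain ⟨u', v', hv', h1', h2'⟩ := hy
  refine ⟨u * v' + u' * v, v * v', Nat.Coprime.mul_left hv hv', ?_, ?_⟩
  · push_cast
    linear_combination (v' : ℚ) * h1 + (v : ℚ) * h1'
  · push_cast
    linear_combination (v' : ZMod N) * h2 + (v : ZMod N) * h2'

theorem mul (hx : ReducesTo N x a) (hy : ReducesTo N y b) : ReducesTo N (x * y) (a * b) := by
  obtain ⟨u, v, hv, h1, h2⟩ := hx
  obtain ⟨u', v', hv', h1', h2'⟩ := hy
  refine ⟨u * u', v * v', Nat.Coprime.mul_left hv hv', ?_, ?_⟩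
  · push_cast
    linear_combination (y * v') * h1 + (u : ℚ) * h1'
  · push_cast
    linear_combination (b * v') * h2 + (u : ZMod N) * h2'

theorem sub (hx : ReducesTo N x a) (hy : ReducesTo N y b) : ReducesTo N (x - y) (a - b) := by
  have := hx.add ((intCast (-1)).mul hy)
  push_cast at this
  simpa only [neg_one_mul, ← sub_eq_add_neg] using this

theorem pow (hx : ReducesTo N x a) (n : ℕ) : ReducesTo N (x ^ n) (a ^ n) := by
  induction n with
  | zero => simpa using natCast (N := N) 1
  | succ n ih => rw [pow_succ, pow_succ]; exact ih.mul hx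

theorem sum {ι : Type*} {s : Finset ι} {f : ι → ℚ} {g : ι → ZMod N}
    (h : ∀ i ∈ s, ReducesTo N (f i) (g i)) : ReducesTo N (∑ i ∈ s, f i) (∑ i ∈ s, g i) := by
  classical
  induction s using Finset.induction_on with
  | empty => simpa using natCast (N := N) 0
  | insert i s hi ih =>
    rw [sum_insert hi, sum_insert hi]
    exact (h i (mem_insert_self i s)).add (ih fun j hj => h j (mem_insert_of_mem hj))

theorem one_div {v : ℕ} (hv : v.Coprime N) (h0 : v ≠ 0) :
    ReducesTo N (1 / (v : ℚ)) (Ring.inverse (v : ZMod N)) := by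
  refine ⟨1, v, hv, by simp [h0], ?_⟩
  rw [Ring.inverse_mul_cancel _ ((ZMod.isUnit_iff_coprime v N).2 hv), Int.cast_one]

theorem coprime_den (hx : ReducesTo N x a) : x.den.Coprime N := by
  obtain ⟨u, v, hv, h1, -⟩ := hx
  -- A zero multiplier v is coprime to N only when N = 1.
  rcases Nat.eq_zero_or_pos v with rfl | hv0
  · obtain rfl : N = 1 := by simpa using hv
    simp
  refine Nat.Coprime.coprime_dvd_left ?_ hv
  have hx : x = (u : ℚ) / ((v : ℤ) : ℚ) := by
    rw [eq_div_iff (by exact_mod_cast hv0.ne')]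
    exact_mod_cast h1
  rw [hx]
  exact_mod_cast Rat.den_dvd u v

theorem dvd_num (hx : ReducesTo N x 0) : (N : ℤ) ∣ x.num := by
  obtain ⟨u, v, hv, h1, h2⟩ := hx
  rw [zero_mul, eq_comm, ZMod.intCast_zmod_eq_zero_iff_dvd] at h2
  have h3 : x.num * v = u * x.den := by
    have h4 := Rat.mul_den_eq_num x
    have : (x.num : ℚ) * v = u * x.den := by
      linear_combination (x.den : ℚ) * h1 - (v : ℚ) * h4
    exact_mod_cast this
  refine IsCoprime.dvd_of_dvd_mul_right (Nat.isCoprime_iff_coprime.2 hv).symm ?_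
  rw [h3]
  exact Dvd.dvd.mul_right h2 _

theorem ratModEq (hx : ReducesTo N x a) (hy : ReducesTo N y a) : RatModEq N x y :=
  ⟨hx.coprime_den, hy.coprime_den, (by simpa using hx.sub hy : ReducesTo N (x - y) 0).dvd_num⟩

theorem unique (hx : ReducesTo N x a) (hx' : ReducesTo N x b) : a = b := by
  obtain ⟨u, v, hv, h1, h2⟩ := by simpa using hx.sub hx'
  have hu : u = 0 := by simpa using h1.symm
  subst hu
  have := (ZMod.isUnit_iff_coprime v N).2 hv
  rw [Int.cast_zero, this.mul_left_eq_zero] at h2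
  exact sub_eq_zero.1 h2

end ReducesTo

/-! ### Bernoulli numbers and Voronoi's congruence -/

/-- The recursion for B_m divides only by m + 1, which is below p. -/
theorem exists_reducesTo_bernoulli {p N : ℕ} (hN : ∀ m, m ≠ 0 → m < p → m.Coprime N) (m : ℕ)
    (hm : m + 1 < p) : ∃ a : ZMod N, ReducesTo N (bernoulli m) a := by
  induction m using Nat.strong_induction_on with
  | _ m ih =>
    choose! g hg using ih
    have hs := sum_bernoulli (m + 1)
    rw [sum_range_succ, Nat.choose_succ_self_right] at hs
    have hi := ReducesTo.one_div (hN (m + 1) (by omega) hm) (by omega)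
    have hsum : ReducesTo N (∑ k ∈ range m, ((m + 1).choose k : ℚ) * bernoulli k)
        (∑ k ∈ range m, ((m + 1).choose k : ZMod N) * g k) :=
      ReducesTo.sum fun k hk => (ReducesTo.natCast _).mul
        (hg k (mem_range.1 hk) (by have := mem_range.1 hk; omega))
    have hB : bernoulli m = ((if m + 1 = 1 then 1 else 0 : ℕ) -
        ∑ k ∈ range m, ((m + 1).choose k : ℚ) * bernoulli k) * (1 / ((m + 1 : ℕ) : ℚ)) := by
      have : ((m + 1 : ℕ) : ℚ) ≠ 0 := by exact_mod_cast Nat.succ_ne_zero m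
      rw [eq_comm, mul_one_div, div_eq_iff this]
      push_cast at hs ⊢
      rw [← hs]
      ring
    rw [hB]
    exact ⟨_, ((ReducesTo.natCast _).sub hsum).mul hi⟩

/-- The power sum `∑ i ^ k` over `i < n` is `n B_k` up to an integral multiple of `n ^ 2`. -/
theorem exists_sum_range_pow_eq {p N : ℕ} (hN : ∀ m, m ≠ 0 → m < p → m.Coprime N) (n k : ℕ)
    (hk : k + 1 < p) : ∃ (c : ℚ) (a : ZMod N), ReducesTo N c a ∧
      (∑ i ∈ range n, (i : ℚ) ^ k) = n * bernoulli k + n ^ 2 * c := by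
  choose! g hg using exists_reducesTo_bernoulli hN
  have hi := ReducesTo.one_div (hN (k + 1) (by omega) hk) (by omega)
  refine ⟨∑ i ∈ range k, bernoulli i * ((k + 1).choose i : ℕ) * (n ^ (k - 1 - i) : ℕ) *
    (1 / ((k + 1 : ℕ) : ℚ)), _, ReducesTo.sum fun i hi' => (((hg i ?_).mul
      (ReducesTo.natCast _)).mul (ReducesTo.natCast _)).mul hi, ?_⟩
  · have := mem_range.1 hi'
    omega
  · have hk0 : (k : ℚ) + 1 ≠ 0 := by positivity
    rw [sum_range_pow, sum_range_succ, add_comm, mul_sum]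
    congr 1
    · rw [Nat.choose_succ_self_right, show k + 1 - k = 1 by omega]
      push_cast
      field_simp
    · refine sum_congr rfl fun i hi' => ?_
      have := mem_range.1 hi'
      rw [show k + 1 - i = 2 + (k - 1 - i) by omega, pow_add]
      push_cast
      ring

/-- Expand (qi - P⌊qi/P⌋)^k to first order modulo P² and sum: the residues qi mod P run over all i <
P. -/
theorem sum_range_mul_div_pow_modEq {q P : ℕ} (hqP : q.Coprime P) (k : ℕ) :
    ∃ d : ℤ, ((q : ℤ) ^ k - 1) * ∑ i ∈ range P, (i : ℤ) ^ k =
      k * q ^ (k - 1) * P * (∑ i ∈ range P, ((q * i / P : ℕ) : ℤ) * (i : ℤ) ^ (k - 1)) +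
        P ^ 2 * d := by
  have key : ∀ i : ℕ, ∃ d : ℤ, ((q * i % P : ℕ) : ℤ) ^ k = (q * i : ℤ) ^ k +
      k * (q * i : ℤ) ^ (k - 1) * (-(P * ((q * i / P : ℕ) : ℤ))) + P ^ 2 * d := by
    intro i
    obtain ⟨d, hd⟩ := Polynomial.powAddExpansion (q * i : ℤ) (-(P * ((q * i / P : ℕ) : ℤ))) k
    refine ⟨d * ((q * i / P : ℕ) : ℤ) ^ 2, ?_⟩
    have h : ((q * i % P : ℕ) : ℤ) = (q * i : ℤ) + -(P * ((q * i / P : ℕ) : ℤ)) := by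
      have := Nat.mod_add_div (q * i) P
      have h' : ((q * i % P : ℕ) : ℤ) + P * ((q * i / P : ℕ) : ℤ) = q * i := by exact_mod_cast this
      linear_combination h'
    rw [h, hd]
    ring
  choose d hd using key
  refine ⟨-∑ i ∈ range P, d i, ?_⟩
  have h := sum_range_mul_mod (fun r => (r : ℤ) ^ k) hqP
  rw [sum_congr rfl fun i _ => hd i, sum_add_distrib, sum_add_distrib, ← mul_sum] at h
  have h1 : ∑ i ∈ range P, (q * i : ℤ) ^ k = q ^ k * ∑ i ∈ range P, (i : ℤ) ^ k := by
    rw [mul_sum]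
    exact sum_congr rfl fun i _ => mul_pow _ _ _
  have h2 : ∑ i ∈ range P, (k * (q * i : ℤ) ^ (k - 1) * (-(P * ((q * i / P : ℕ) : ℤ)))) =
      -(k * q ^ (k - 1) * P * ∑ i ∈ range P, ((q * i / P : ℕ) : ℤ) * (i : ℤ) ^ (k - 1)) := by
    rw [mul_sum, ← sum_neg_distrib]
    exact sum_congr rfl fun i _ => by rw [mul_pow]; ring
  rw [h1, h2] at h
  linear_combination h

/-- Voronoi's congruence, modulo a number all of whose prime factors are at least `p`. -/
theorem voronoi_congruence {p N q : ℕ} (hN0 : N ≠ 0)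
    (hN : ∀ m, m ≠ 0 → m < p → m.Coprime N) (hqN : q.Coprime N)
    (k : ℕ) (hk : k + 1 < p) {b : ZMod N} (hb : ReducesTo N (bernoulli k) b) :
    ((q : ZMod N) ^ k - 1) * b =
      k * q ^ (k - 1) * ∑ i ∈ range N, ((q * i / N : ℕ) : ZMod N) * (i : ZMod N) ^ (k - 1) := by
  obtain ⟨c, a, hc, hS⟩ := exists_sum_range_pow_eq hN N k hk
  obtain ⟨d, hd⟩ := sum_range_mul_div_pow_modEq hqN k
  set Y : ℤ := ∑ i ∈ range N, ((q * i / N : ℕ) : ℤ) * (i : ℤ) ^ (k - 1) with hY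
  have hd' : ((q : ℚ) ^ k - 1) * ∑ i ∈ range N, (i : ℚ) ^ k =
      k * q ^ (k - 1) * N * Y + N ^ 2 * d := by exact_mod_cast hd
  have hNQ : (N : ℚ) ≠ 0 := by exact_mod_cast hN0
  have hmain : (((q : ℤ) ^ k - 1 : ℤ) : ℚ) * bernoulli k =
      ((k * q ^ (k - 1) * Y : ℤ) : ℚ) + (N : ℚ) * ((d : ℚ) - (((q : ℤ) ^ k - 1 : ℤ) : ℚ) * c) := by
    -- Both sides carry a factor N, cancelled in ℚ; the errors of order N² thereby still vanish mod
    -- N.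
    refine mul_left_cancel₀ hNQ ?_
    rw [hS] at hd'
    push_cast
    linear_combination hd'
  have h1 := (ReducesTo.intCast ((q : ℤ) ^ k - 1)).mul hb
  rw [hmain] at h1
  have h2 := (ReducesTo.intCast (N := N) (k * q ^ (k - 1) * Y)).add ((ReducesTo.natCast N).mul
    ((ReducesTo.intCast d).sub ((ReducesTo.intCast ((q : ℤ) ^ k - 1)).mul hc)))
  have h3 := h1.unique h2
  rw [ZMod.natCast_self, zero_mul, add_zero, hY] at h3
  simpa only [Int.cast_sub, Int.cast_mul, Int.cast_pow, Int.cast_sum, Int.cast_natCast,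
    Int.cast_one] using h3

/-! ### Evaluation through B_{p-3} -/

section
variable {p α : ℕ}

theorem prime_pow_pred_mul_eq_zero (hα : 1 ≤ α) :
    (p : ZMod (p ^ α)) ^ (α - 1) * (p : ZMod (p ^ α)) = 0 := by
  rw [← pow_succ, Nat.sub_add_cancel hα, ← Nat.cast_pow, ZMod.natCast_self]

theorem isUnit_natCast_of_coprime {v : ℕ} (hv : v.Coprime p) :
    IsUnit (v : ZMod (p ^ α)) :=
  (ZMod.isUnit_iff_coprime _ _).2 (hv.pow_right α)

theorem invMod_mul_self {v : ℕ} (hv : v.Coprime p) : invMod p α v * v = 1 :=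
  Ring.inverse_mul_cancel _ (isUnit_natCast_of_coprime hv)

/-- Fermat's little theorem after multiplication by `p ^ (α - 1)`. -/
theorem prime_pow_pred_mul_pow [hp : Fact p.Prime] (hα : 1 ≤ α) {v : ℕ} (hv : v.Coprime p) :
    (p : ZMod (p ^ α)) ^ (α - 1) * (v : ZMod (p ^ α)) ^ (p - 1) =
      (p : ZMod (p ^ α)) ^ (α - 1) := by
  have h := Nat.ModEq.pow_totient hv
  rw [Nat.totient_prime hp.out] at h
  obtain ⟨d, hd⟩ := h.symm.dvd
  have hd' : (v : ZMod (p ^ α)) ^ (p - 1) - 1 = p * (d : ZMod (p ^ α)) := by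
    have := congrArg (Int.cast : ℤ → ZMod (p ^ α)) hd
    push_cast at this
    exact this
  have h0 := prime_pow_pred_mul_eq_zero (p := p) hα
  linear_combination (p : ZMod (p ^ α)) ^ (α - 1) * hd' + d * h0

theorem prime_pow_pred_mul_pow_eq_invMod [hp : Fact p.Prime] (hα : 1 ≤ α) {v : ℕ}
    (hv : v.Coprime p) {m l : ℕ} (hml : m + l = p - 1) :
    (p : ZMod (p ^ α)) ^ (α - 1) * (v : ZMod (p ^ α)) ^ m =
      (p : ZMod (p ^ α)) ^ (α - 1) * invMod p α v ^ l := by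
  have h := prime_pow_pred_mul_pow hα hv
  have h1 : invMod p α v ^ l * (v : ZMod (p ^ α)) ^ l = 1 := by
    rw [← mul_pow, invMod_mul_self hv, one_pow]
  rw [← hml, pow_add] at h
  linear_combination invMod p α v ^ l * h - (p : ZMod (p ^ α)) ^ (α - 1) * v ^ m * h1

theorem coprime_prime_pow_of_lt [hp : Fact p.Prime] (m : ℕ) (h0 : m ≠ 0) (hm : m < p) :
    m.Coprime (p ^ α) :=
  (Nat.coprime_of_lt_prime h0 hm hp.out).symm.pow_right α

/-- For p > 3 this is Voronoi with k = p - 3: the factor p^(α-1) makes k act as -3 and, by Fermat,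
the powers p - 3 and p - 4 as -2 and -3 on numbers prime to p. -/
theorem three_mul_voronoi_sum [hp : Fact p.Prime] (hα : 1 ≤ α) (hp2 : p ≠ 2) {q : ℕ}
    (hq : q.Coprime p) {b : ZMod (p ^ α)} (hb : ReducesTo (p ^ α) (bernoulli (p - 3)) b) :
    3 * ((p : ZMod (p ^ α)) ^ (α - 1) * invMod p α q ^ 3 *
      ∑ i ∈ range (p ^ α), ((q * i / p ^ α : ℕ) : ZMod (p ^ α)) * invMod p α i ^ 3) =
      (p : ZMod (p ^ α)) ^ (α - 1) * (1 - invMod p α q ^ 2) * b := by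
  have h0 := prime_pow_pred_mul_eq_zero (p := p) hα
  have hp3 : 3 ≤ p := by have := hp.out.two_le; omega
  rcases hp3.eq_or_lt with rfl | hp4
  -- For p = 3 both sides vanish: 3^(α-1) kills 3, and also 1 - q⁻² by Fermat.
  · have h1 := prime_pow_pred_mul_pow_eq_invMod hα hq (m := 0) (l := 2) rfl
    push_cast at h0 h1 ⊢
    linear_combination (invMod 3 α q ^ 3 *
      ∑ i ∈ range (3 ^ α), ((q * i / 3 ^ α : ℕ) : ZMod (3 ^ α)) * invMod 3 α i ^ 3) * h0 - b * h1
  · have hp5 : 5 ≤ p := by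
      rcases (Nat.succ_le_of_lt hp4).eq_or_lt with h | h
      · rw [← h] at hp; exact absurd hp.out (by norm_num)
      · omega
    have hV := voronoi_congruence (p := p) (pow_ne_zero α hp.out.ne_zero)
      coprime_prime_pow_of_lt (hq.pow_right α) (p - 3) (by omega) hb
    have hY : (p : ZMod (p ^ α)) ^ (α - 1) * ∑ i ∈ range (p ^ α),
        ((q * i / p ^ α : ℕ) : ZMod (p ^ α)) * (i : ZMod (p ^ α)) ^ (p - 3 - 1) =
        (p : ZMod (p ^ α)) ^ (α - 1) * ∑ i ∈ range (p ^ α),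
        ((q * i / p ^ α : ℕ) : ZMod (p ^ α)) * invMod p α i ^ 3 := by
      rw [mul_sum, mul_sum]
      refine sum_congr rfl fun i _ => ?_
      rw [mul_left_comm, mul_left_comm ((p : ZMod (p ^ α)) ^ (α - 1))]
      congr 1
      by_cases hi : p ∣ i
      · rw [invMod, Ring.inverse_non_unit _ (by rw [isUnit_natCast_zmod_prime_pow hα]; simpa)]
        obtain ⟨j, rfl⟩ := hi
        -- The exponent is positive since p ≥ 5, so a multiple of p contributes a factor p, killed
        -- by p^(α-1).
        rw [show p - 3 - 1 = (p - 5) + 1 by omega, pow_succ]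
        push_cast
        linear_combination ((p : ZMod (p ^ α)) * j) ^ (p - 5) * j * h0
      · exact prime_pow_pred_mul_pow_eq_invMod hα
          ((hp.out.coprime_iff_not_dvd.2 hi).symm) (by omega)
    have e1 := prime_pow_pred_mul_pow_eq_invMod hα hq (m := p - 3) (l := 2) (by omega)
    have e2 := prime_pow_pred_mul_pow_eq_invMod hα hq (m := p - 3 - 1) (l := 3) (by omega)
    rw [Nat.cast_sub hp3] at hV
    push_cast at hV
    set e := (p : ZMod (p ^ α)) ^ (α - 1)
    set S := ∑ i ∈ range (p ^ α), ((q * i / p ^ α : ℕ) : ZMod (p ^ α)) * (i : ZMod (p ^ α)) ^ (p - 3 - 1)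
    linear_combination e * hV - b * e1 - 3 * invMod p α q ^ 3 * hY - 3 * S * e2 + q ^ (p - 3 - 1) * S * h0

/-- The sum over triples prime to `q` in terms of the sum over all triples. -/
theorem coeff_invMod_restrictNotDvd [hp : Fact p.Prime] (hα : 1 ≤ α) (hp2 : p ≠ 2) {q : ℕ}
    (hq0 : q ≠ 0) (hq : q.Coprime p) {b : ZMod (p ^ α)}
    (hb : ReducesTo (p ^ α) (bernoulli (p - 3)) b) :
    coeff (q * p ^ α) (PowerSeries.mk (restrictNotDvd q (invMod p α)) ^ 3) =
      (q - 3 + 2 * invMod p α q ^ 3) * coeff (p ^ α) (PowerSeries.mk (invMod p α) ^ 3) -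
        2 * ((p : ZMod (p ^ α)) ^ (α - 1) * (1 - invMod p α q ^ 2) * b) := by
  have h2 : IsUnit (2 : ZMod (p ^ α)) := by
    have := isUnit_natCast_of_coprime (α := α) (v := 2)
      ((Nat.coprime_primes Nat.prime_two hp.out).2 hp2.symm)
    exact_mod_cast this
  rw [coeff_restrictNotDvd_cube (dvd_mul_right q _), oddPeriodic_invMod.coeff_cube h2,
    coeff_invMod_restrictDvd hα h2 hq0 hq, coeff_restrictDvd_cube hq0 (fun i => invMod_mul q i),
    ← three_mul_voronoi_sum hα hp2 hq hb]
  ring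

/-- Put 2 for q: no three odd numbers sum to 2p^α, so 0 = -(3/4)T - (3/2)p^(α-1)b. -/
theorem coeff_invMod_cube_three [hp : Fact p.Prime] (hα : 1 ≤ α) (hp2 : p ≠ 2)
    {b : ZMod (p ^ α)} (hb : ReducesTo (p ^ α) (bernoulli (p - 3)) b) :
    3 * coeff (p ^ α) (PowerSeries.mk (invMod p α) ^ 3) =
      -6 * ((p : ZMod (p ^ α)) ^ (α - 1) * b) := by
  have hc : Nat.Coprime 2 p := (Nat.coprime_primes Nat.prime_two hp.out).2 hp2.symm
  have h := coeff_invMod_restrictNotDvd hα hp2 two_ne_zero hc hb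
  rw [coeff_odd_cube_of_even (even_two.mul_right _)] at h
  have hs := invMod_mul_self (α := α) hc
  push_cast at h hs
  set s := invMod p α 2
  set T := coeff (p ^ α) (PowerSeries.mk (invMod p α) ^ 3)
  have h4 : s ^ 2 * 4 = 1 := by linear_combination (s * 2 + 1) * hs
  have h8 : s ^ 3 * 8 = 1 := by linear_combination (s ^ 2 * 4 + s * 2 + 1) * hs
  linear_combination 4 * h + T * h8 + 2 * (p : ZMod (p ^ α)) ^ (α - 1) * b * h4

theorem coeff_invMod_restrictNotDvd_eq [hp : Fact p.Prime] (hα : 1 ≤ α) (hp2 : p ≠ 2) {q : ℕ}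
    (hq0 : q ≠ 0) (hq : q.Coprime p) {b : ZMod (p ^ α)}
    (hb : ReducesTo (p ^ α) (bernoulli (p - 3)) b) :
    coeff (q * p ^ α) (PowerSeries.mk (restrictNotDvd q (invMod p α)) ^ 3) =
      2 * (2 - q) * (1 - invMod p α q ^ 3) * (p : ZMod (p ^ α)) ^ (α - 1) * b := by
  rw [coeff_invMod_restrictNotDvd hα hp2 hq0 hq hb]
  have hT := coeff_invMod_cube_three hα hp2 hb
  have hc := invMod_mul_self (α := α) hq
  have h0 := prime_pow_pred_mul_eq_zero (p := p) hα
  by_cases hp3 : p = 3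
  · subst hp3
    have h1 := prime_pow_pred_mul_pow_eq_invMod hα hq (m := 0) (l := 2) rfl
    have hq2 : ∃ d : ZMod (3 ^ α), (q : ZMod (3 ^ α)) ^ 2 = 1 + 3 * d := by
      have h := Nat.ModEq.pow_totient hq
      rw [Nat.totient_prime hp.out] at h
      obtain ⟨d, hd⟩ := h.symm.dvd
      have := congrArg (Int.cast : ℤ → ZMod (3 ^ α)) hd
      push_cast at this
      exact ⟨d, by linear_combination this⟩
    obtain ⟨d, hd⟩ := hq2
    rw [Nat.cast_ofNat] at h0 h1 hT ⊢
    set c := invMod 3 α q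
    set T := coeff (3 ^ α) (PowerSeries.mk (invMod 3 α) ^ 3)
    set e := (3 : ZMod (3 ^ α)) ^ (α - 1)
    have hT0 : 3 * T = 0 := by rw [hT]; linear_combination (-2 * b) * h0
    have hc3 : c ^ 3 * q ^ 3 = 1 := by rw [← mul_pow, hc, one_pow]
    -- Here q + 2c³ = c³(q⁴ + 2), and q² = 1 + 3d makes q⁴ + 2 a multiple of 3, which kills T.
    have e1 : ((q : ZMod (3 ^ α)) - 3 + 2 * c ^ 3) * T = 0 := by
      have : (q : ZMod (3 ^ α)) = c ^ 3 * (q ^ 2) ^ 2 := by linear_combination (-(q : ZMod (3 ^ α))) * hc3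
      rw [hd] at this
      rw [this]
      linear_combination (c ^ 3 * (1 + 2 * d + 3 * d ^ 2) - 1) * hT0
    have e2 : e * (1 - c ^ 2) = 0 := by linear_combination h1
    have e3 : (2 - (q : ZMod (3 ^ α))) * (1 - c ^ 3) * e = 0 := by
      linear_combination (1 - c) * h0 + (c * (2 - q) - q) * e2 + (1 - c) * e * hc
    rw [e1, e2]
    linear_combination (-2 * b) * e3
  · have h3 : IsUnit (3 : ZMod (p ^ α)) := by
      have := isUnit_natCast_of_coprime (α := α) (v := 3)
        ((Nat.coprime_primes Nat.prime_three hp.out).2 (Ne.symm hp3))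
      exact_mod_cast this
    have hT' : coeff (p ^ α) (PowerSeries.mk (invMod p α) ^ 3) =
        -2 * ((p : ZMod (p ^ α)) ^ (α - 1) * b) :=
      h3.mul_left_cancel (by rw [hT]; ring)
    rw [hT']
    set c := invMod p α q
    linear_combination (-2 * (p : ZMod (p ^ α)) ^ (α - 1) * b * c ^ 2) * hc

end

/-! ### From sums over triples to coefficients, and conclusion -/

theorem coeff_mk_cube {R : Type*} [CommRing R] {G : ℕ → R} (h0 : G 0 = 0) (n : ℕ) :
    coeff n (PowerSeries.mk G ^ 3) =
      ∑ t ∈ (Icc 1 n ×ˢ Icc 1 n ×ˢ Icc 1 n).filter (fun t => t.1 + t.2.1 + t.2.2 = n),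
        G t.1 * G t.2.1 * G t.2.2 := by
  rw [pow_succ', coeff_mul]
  simp only [sq, coeff_mul, coeff_mk, mul_sum]
  rw [sum_sigma', eq_comm]
  -- The antidiagonals also contain triples with a zero entry; G(0) = 0 removes them.
  refine sum_bij_ne_zero (fun t _ _ => ⟨(t.1, t.2.1 + t.2.2), t.2⟩) ?_ ?_ ?_ ?_
  · intro t ht _
    simp only [mem_filter] at ht
    simp [← ht.2, add_assoc]
  · rintro ⟨i, j, k⟩ _ _ ⟨i', j', k'⟩ _ _ h
    simp at h
    simp [h]
  · rintro ⟨⟨i, m⟩, ⟨j, k⟩⟩ hx hne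
    simp only [mem_sigma, HasAntidiagonal.mem_antidiagonal] at hx
    have pos : ∀ l, G l ≠ 0 → 1 ≤ l := fun l hl =>
      Nat.one_le_iff_ne_zero.2 fun h => hl (h ▸ h0)
    have hi := pos i (left_ne_zero_of_mul hne)
    have hj := pos j (left_ne_zero_of_mul (right_ne_zero_of_mul hne))
    have hk := pos k (right_ne_zero_of_mul (right_ne_zero_of_mul hne))
    obtain ⟨h1, rfl⟩ := hx
    refine ⟨(i, j, k), ?_, by simpa [mul_assoc] using hne, rfl⟩
    simp only [mem_filter, mem_product, mem_Icc]
    omega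
  · intro t _ _
    simp [mul_assoc]

theorem reducesTo_sum_triples {p : ℕ} (α : ℕ) (Q : ℕ → Prop) [DecidablePred Q]
    (hQ : ∀ i, Q i → i.Coprime p) (n : ℕ) :
    ReducesTo (p ^ α)
      (∑ t ∈ (Icc 1 n ×ˢ Icc 1 n ×ˢ Icc 1 n).filter
        (fun t => t.1 + t.2.1 + t.2.2 = n ∧ Q t.1 ∧ Q t.2.1 ∧ Q t.2.2),
        1 / ((t.1 : ℚ) * (t.2.1 : ℚ) * (t.2.2 : ℚ)))
      (coeff n (PowerSeries.mk (fun i => if Q i then invMod p α i else 0) ^ 3)) := by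
  rw [coeff_mk_cube (by simp [oddPeriodic_invMod.zero])]
  have key : ∑ t ∈ (Icc 1 n ×ˢ Icc 1 n ×ˢ Icc 1 n).filter
        (fun t => t.1 + t.2.1 + t.2.2 = n ∧ Q t.1 ∧ Q t.2.1 ∧ Q t.2.2),
        invMod p α t.1 * invMod p α t.2.1 * invMod p α t.2.2 =
      ∑ t ∈ (Icc 1 n ×ˢ Icc 1 n ×ˢ Icc 1 n).filter (fun t => t.1 + t.2.1 + t.2.2 = n),
        (if Q t.1 then invMod p α t.1 else 0) * (if Q t.2.1 then invMod p α t.2.1 else 0) *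
          (if Q t.2.2 then invMod p α t.2.2 else 0) := by
    rw [← filter_filter, sum_filter]
    refine sum_congr rfl fun t _ => ?_
    by_cases h1 : Q t.1 <;> by_cases h2 : Q t.2.1 <;> by_cases h3 : Q t.2.2 <;> simp [h1, h2, h3]
  rw [← key]
  refine ReducesTo.sum fun t ht => ?_
  simp only [mem_filter, mem_product, mem_Icc] at ht
  obtain ⟨⟨⟨h1, -⟩, ⟨h2, -⟩, h3, -⟩, -, hQ1, hQ2, hQ3⟩ := ht
  have one : ∀ i : ℕ, 1 ≤ i → Q i → ReducesTo (p ^ α) (1 / (i : ℚ)) (invMod p α i) :=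
    fun i hi hQi => ReducesTo.one_div ((hQ i hQi).pow_right α) (by omega)
  have := ((one _ h1 hQ1).mul (one _ h2 hQ2)).mul (one _ h3 hQ3)
  rwa [div_mul_div_comm, div_mul_div_comm, one_mul, one_mul] at this

section
variable {p q : ℕ}

theorem ite_coprime_invMod [hp : Fact p.Prime] (hq : q.Prime) {α : ℕ} (hα : 1 ≤ α) {a b : ℕ}
    (ha : a ≠ 0) (hb : b ≠ 0) (i : ℕ) :
    (if i.Coprime (p ^ a * q ^ b) then invMod p α i else 0) =
      restrictNotDvd q (invMod p α) i := by
  have hc : i.Coprime (p ^ a * q ^ b) ↔ ¬ p ∣ i ∧ ¬ q ∣ i := by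
    rw [Nat.coprime_mul_iff_right, Nat.coprime_pow_right_iff (Nat.pos_of_ne_zero ha),
      Nat.coprime_pow_right_iff (Nat.pos_of_ne_zero hb), Nat.coprime_comm,
      hp.out.coprime_iff_not_dvd, Nat.coprime_comm, hq.coprime_iff_not_dvd]
  rw [restrictNotDvd]
  by_cases hpi : p ∣ i
  · have : invMod p α i = 0 :=
      Ring.inverse_non_unit _ (by rw [isUnit_natCast_zmod_prime_pow hα]; simpa)
    simp [this]
  · by_cases hqi : q ∣ i <;> simp [hc, hpi, hqi]

theorem reducesTo_harmonicZ [hp : Fact p.Prime] (hq : q.Prime) {α β : ℕ}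
    (hα : 1 ≤ α) (hβ : 1 ≤ β) :
    ReducesTo (p ^ α) (harmonicZ (p ^ α * q ^ β))
      (coeff (p ^ α * q ^ β) (PowerSeries.mk (restrictNotDvd q (invMod p α)) ^ 3)) := by
  have h := reducesTo_sum_triples (p := p) α (fun i => i.Coprime (p ^ α * q ^ β)) (fun i hi =>
    (hi.coprime_mul_right_right).coprime_dvd_right (dvd_pow_self p (by omega)))
    (p ^ α * q ^ β)
  simp only [ite_coprime_invMod hq hα (show α ≠ 0 by omega) (show β ≠ 0 by omega)] at h
  exact h

theorem reducesTo_oddHarmonicSum [hp : Fact p.Prime] (hq : q.Prime) {α : ℕ} (hα : 1 ≤ α) (n : ℕ) :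
    ReducesTo (p ^ α) (oddHarmonicSum n (p * q))
      (coeff n (PowerSeries.mk (restrictNotDvd 2 (restrictNotDvd q (invMod p α))) ^ 3)) := by
  have h := reducesTo_sum_triples (p := p) α (fun i => i.Coprime (p * q) ∧ Odd i)
    (fun i hi => hi.1.coprime_mul_right_right) n
  have hG : (fun i => if i.Coprime (p * q) ∧ Odd i then invMod p α i else 0) =
      restrictNotDvd 2 (restrictNotDvd q (invMod p α)) := by
    funext i
    have h1 := ite_coprime_invMod hq hα one_ne_zero one_ne_zero (p := p) i
    rw [pow_one, pow_one] at h1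
    simp only [restrictNotDvd.eq_def 2, ← h1, ← even_iff_two_dvd, ← Nat.not_even_iff_odd]
    split_ifs <;> simp_all
  rw [hG] at h
  rw [oddHarmonicSum, coprimeTriples, filter_filter]
  convert h using 3
  tauto

end

theorem theorem3 (p q α β : ℕ) (hp : p.Prime) (hq : q.Prime) (hp2 : p ≠ 2) (hq2 : q ≠ 2)
    (hpq : p ≠ q) (hα : 1 ≤ α) (hβ : 1 ≤ β) :
    RatModEq (p ^ α) (oddHarmonicSum (p ^ α * q ^ β) (p * q))
        (7 / 16 * harmonicZ (p ^ α * q ^ β)) ∧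
      RatModEq (p ^ α) (7 / 16 * harmonicZ (p ^ α * q ^ β))
        (7 / 8 * (2 - (q : ℚ)) * (1 - 1 / (q : ℚ) ^ 3) * (p : ℚ) ^ (α - 1) *
          (q : ℚ) ^ (β - 1) * bernoulli (p - 3)) := by
  have : Fact p.Prime := ⟨hp⟩
  have h2p : Nat.Coprime 2 p := (Nat.coprime_primes Nat.prime_two hp).2 hp2.symm
  have hqp : q.Coprime p := (Nat.coprime_primes hq hp).2 hpq.symm
  have hqodd : Odd q := hq.odd_of_ne_two hq2
  have hs := invMod_mul_self (α := α) h2p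
  set s := invMod p α 2 with hsdef
  have hs' : 2 * s = 1 := by rw [mul_comm]; exact_mod_cast hs
  have h2 : IsUnit (2 : ZMod (p ^ α)) := IsUnit.of_mul_eq_one s hs'
  have hF : OddPeriodic (restrictNotDvd q (invMod p α)) (q * p ^ α) :=
    oddPeriodic_invMod.restrictNotDvd q
  have hdil : ∀ i, restrictNotDvd q (invMod p α) (2 * i) =
      s * restrictNotDvd q (invMod p α) i := by
    intro i
    have : q ∣ 2 * i ↔ q ∣ i :=
      ⟨((Nat.coprime_primes hq Nat.prime_two).2 hq2).dvd_of_dvd_mul_left,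
        fun h => h.mul_left 2⟩
    simp only [restrictNotDvd, this, invMod_mul]
    split_ifs <;> simp [hsdef]
  have hn : p ^ α * q ^ β = q ^ (β - 1) * (q * p ^ α) := by
    rw [← mul_assoc, ← pow_succ, Nat.sub_add_cancel hβ, mul_comm]
  obtain ⟨b, hb⟩ := exists_reducesTo_bernoulli (coprime_prime_pow_of_lt (p := p) (α := α)) (p - 3)
    (by have := hp.two_le; omega)
  -- The period is q p^α, since removing multiples of q enlarges it, and the odd multiplier is N =
  -- q^(β-1).
  have hodd := hF.sixteen_mul_coeff_odd_cube (hqodd.mul (hp.odd_of_ne_two hp2).pow) hs' hdil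
    (hqodd.pow (n := β - 1))
  have hval := hF.coeff_cube h2 (q ^ (β - 1))
  rw [coeff_invMod_restrictNotDvd_eq hα hp2 hq.ne_zero hqp hb] at hval
  have hrZ := reducesTo_harmonicZ (p := p) hq hα hβ
  have hro := reducesTo_oddHarmonicSum (p := p) hq hα (p ^ α * q ^ β)
  rw [hn] at hrZ hro
  rw [hn]
  have hhalf : ReducesTo (p ^ α) (1 / 2) s := by
    have := ReducesTo.one_div (h2p.pow_right α) two_ne_zero
    exact_mod_cast this
  have hqinv : ReducesTo (p ^ α) (1 / (q : ℚ)) (invMod p α q) :=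
    ReducesTo.one_div (hqp.pow_right α) hq.ne_zero
  have h7 := ReducesTo.natCast (N := p ^ α) 7
  have h1 := ReducesTo.natCast (N := p ^ α) 1
  have h2' := ReducesTo.natCast (N := p ^ α) 2
  have hrq := ReducesTo.natCast (N := p ^ α) q
  have hrp := ReducesTo.natCast (N := p ^ α) p
  have hmid := (h7.mul (hhalf.pow 4)).mul hrZ
  have hrhs := (((((h7.mul (hhalf.pow 3)).mul (h2'.sub hrq)).mul (h1.sub (hqinv.pow 3))).mul
    (hrp.pow (α - 1))).mul (hrq.pow (β - 1))).mul hb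
  have e16 : ((7 : ℕ) : ℚ) * (1 / 2) ^ 4 = 7 / 16 := by norm_num
  have e8 : ((7 : ℕ) : ℚ) * (1 / 2) ^ 3 = 7 / 8 := by norm_num
  rw [e16] at hmid
  rw [e8, one_div_pow, Nat.cast_one, Nat.cast_ofNat] at hrhs
  have s3 : 8 * s ^ 3 = 1 := by linear_combination (4 * s ^ 2 + 2 * s + 1) * hs'
  have s4 : 16 * s ^ 4 = 1 := by linear_combination (8 * s ^ 3 + 4 * s ^ 2 + 2 * s + 1) * hs'
  constructor
  · refine hro.ratModEq ?_
    convert hmid using 1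
    push_cast
    linear_combination s ^ 4 * hodd - coeff (q ^ (β - 1) * (q * p ^ α)) (PowerSeries.mk
      (restrictNotDvd 2 (restrictNotDvd q (invMod p α))) ^ 3) * s4
  · refine hmid.ratModEq ?_
    convert hrhs using 1
    rw [hval]
    push_cast
    linear_combination (7 * s ^ 3 * q ^ (β - 1) * (2 - q) * (1 - invMod p α q ^ 3) *
      p ^ (α - 1) * b) * hs'
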